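/- **Ruan's Theorem.** Let $X$ be a complex linear space, equipped for each $n\in\mathbb N$ with a norm $\mathcal O_n$ on the space $\mathbb M_n(X)$ of $n\times n$ matrices over $X$, such that $(X,\mathcal O_n)$ is an (abstract) operator space, that is, $$\mathcal O_{m+n}\left(\begin{bmatrix} x & 0\\ 0 & y\end{bmatrix}\right)=\max\{\mathcal O_m(x),\mathcal O_n(y)\},\qquad \mathcal O_n(\alpha x\beta)\le \|\alpha\|\,\mathcal O_m(x)\,\|\beta\|$$ for all $m,n$, all $x\in\mathbb M_m(X)$, $y\in\mathbb M_n(X)$, and all scalar matrices $\alpha\in M_{n,m}(\mathbb C)$, $\beta\in M_{m,n}(\mathbb C)$, where $\|\alpha\|$, $\|\beta\|$ are operator norms between Euclidean spaces. Then there exist a complex Hilbert space $\mathcal H$, a concrete operator space $Y\subset\mathbb B(\mathcal H)$ (a linear subspace, with $\mathbb M_n(Y)$ normed by the operator norm $\|\cdot\|_n$ of $\mathbb M_n(\mathbb B(\mathcal H))=\mathbb B(\mathcal H^n)$, $\mathcal H^n$ being the Hilbert space direct sum), and a complete isometry $\Psi$ from $(X,\mathcal O_n)$ onto $(Y,\|\cdot\|_n)$,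 that is, a linear map $\Psi$ of $X$ onto $Y$ with $$\|[\Psi(x_{ij})]\|_n=\mathcal O_n([x_{ij}])\qquad\text{for all } n\in\mathbb N \text{ and } [x_{ij}]\in\mathbb M_n(X).$$ -/

import Mathlib

universe u

/-- A sequence of seminorms `O n`, one on each space `M_n(X)` of `n × n` matrices over a complex
linear space `X`. (`M_0(X)` is the zero space, so that the term `n = 0` carries no
information.) -/
abbrev MatrixSeminorms (X : Type*) [AddCommGroup X] [Module ℂ X] :=
  ∀ n : ℕ, Seminorm ℂ (Matrix (Fin n) (Fin n) X)

/-- The block diagonal matrix with blocks `x` and `y`, an element of `M_{m+n}(X)`. -/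
def matrixDirectSum {X : Type*} [AddCommGroup X] {m n : ℕ}
    (x : Matrix (Fin m) (Fin m) X) (y : Matrix (Fin n) (Fin n) X) :
    Matrix (Fin (m + n)) (Fin (m + n)) X :=
  Matrix.reindex finSumFinEquiv finSumFinEquiv (Matrix.fromBlocks x 0 0 y)

/-- The product `α x β` of a matrix `x` over `X` with scalar matrices `α` and `β`. -/
def scalarMatrixMul {X : Type*} [AddCommGroup X] [Module ℂ X] {m n : ℕ}
    (α : Matrix (Fin n) (Fin m) ℂ) (x : Matrix (Fin m) (Fin m) X)
    (β : Matrix (Fin m) (Fin n) ℂ) : Matrix (Fin n) (Fin n) X :=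
  Matrix.of fun i j => ∑ k, ∑ l, (α i k * β l j) • x k l

section

open scoped Matrix.Norms.L2Operator

/-- `(X, O)` is an (abstract) operator space: every `O n` is a norm on `M_n(X)`, and Ruan's axioms
hold. Here `‖α‖` is the operator norm of a scalar matrix acting between Euclidean spaces. -/
structure IsOperatorSpace {X : Type*} [AddCommGroup X] [Module ℂ X]
    (O : MatrixSeminorms X) : Prop where
  eq_zero_of_norm_eq_zero : ∀ (n : ℕ) (x : Matrix (Fin n) (Fin n) X), O n x = 0 → x = 0
  norm_directSum : ∀ (m n : ℕ) (x : Matrix (Fin m) (Fin m) X) (y : Matrix (Fin n) (Fin n) X),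
    O (m + n) (matrixDirectSum x y) = max (O m x) (O n y)
  norm_scalarMul_le : ∀ (m n : ℕ) (α : Matrix (Fin n) (Fin m) ℂ) (x : Matrix (Fin m) (Fin m) X)
    (β : Matrix (Fin m) (Fin n) ℂ),
    O n (scalarMatrixMul α x β) ≤ ‖α‖ * O m x * ‖β‖

end

/-- The identification of `M_n(B(H))` with `B(H^n)`, where `H^n` is the Hilbert space direct sum:
the matrix `a` acts on `ξ` by `(a ξ)_i = ∑ j, a_{ij} ξ_j`. -/
noncomputable def matrixToOperator {H : Type*} [NormedAddCommGroup H] [InnerProductSpace ℂ H]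
    (n : ℕ) : Matrix (Fin n) (Fin n) (H →L[ℂ] H) →ₗ[ℂ]
      (PiLp 2 (fun _ : Fin n => H) →L[ℂ] PiLp 2 (fun _ : Fin n => H)) where
  toFun a := ((PiLp.continuousLinearEquiv 2 ℂ (fun _ : Fin n => H)).symm :
      (Fin n → H) →L[ℂ] PiLp 2 (fun _ : Fin n => H)) ∘L
    ContinuousLinearMap.pi fun i => ∑ j, a i j ∘L PiLp.proj 2 (fun _ : Fin n => H) j
  map_add' a b := by
    ext ξ i
    simp [Finset.sum_add_distrib]
  map_smul' c a := by
    ext ξ i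
    simp [Finset.smul_sum]

theorem matrixToOperator_apply {H : Type*} [NormedAddCommGroup H] [InnerProductSpace ℂ H]
    (n : ℕ) (a : Matrix (Fin n) (Fin n) (H →L[ℂ] H)) (ξ : PiLp 2 (fun _ : Fin n => H))
    (i : Fin n) : matrixToOperator n a ξ i = ∑ j, a i j (ξ j) := by
  simp [matrixToOperator]

/-- The matrix norms of the concrete operator space `Y ⊆ B(H)`: the norm of `y ∈ M_n(Y)` is the
operator norm of `y` as an operator on `H^n`. -/
noncomputable def concreteMatrixNorms {H : Type*} [NormedAddCommGroup H] [InnerProductSpace ℂ H]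
    (Y : Submodule ℂ (H →L[ℂ] H)) : MatrixSeminorms Y := fun n =>
  (normSeminorm ℂ (PiLp 2 (fun _ : Fin n => H) →L[ℂ] PiLp 2 (fun _ : Fin n => H))).comp
    (matrixToOperator n ∘ₗ Y.subtype.mapMatrix)

/-- The linear map `φ` is a complete isometry: every amplification
`φ_n [x_{ij}] = [φ (x_{ij})]` preserves the norm. -/
def IsCompleteIsometry {X Y : Type*} [AddCommGroup X] [Module ℂ X] [AddCommGroup Y] [Module ℂ Y]
    (O : MatrixSeminorms X) (P : MatrixSeminorms Y) (φ : X →ₗ[ℂ] Y) : Prop :=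
  ∀ (n : ℕ) (x : Matrix (Fin n) (Fin n) X), P n (x.map φ) = O n x

-- It suffices to almost norm each `x₀` in `M_n(X)` by a complete contraction `T` into operators on
-- `ℂⁿ`: the Hilbert sum of all such contractions is then a complete isometry onto its range.
--
-- To find `T`, take a Hahn–Banach functional `F` with `Re F ≤ O n` and `Re F(x₀) = O n x₀`. Ruan's
-- axioms say that the triples `(φ⋆φ, ψ⋆ψ, 2F(φ⋆xψ))` with `O r x ≤ 1` form a convex cone that
-- misses the open set `‖A‖ + ‖B‖ < Re t`. Separation (`IsOperatorSpace.exists_re_le_add`) yields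
-- `G₁`, `G₂` with `2 Re F(φ⋆xψ) ≤ Re G₁(φ⋆φ) + Re G₂(ψ⋆ψ)` and `Re G₁(1) + Re G₂(1) ≤ 2`.
--
-- As in the GNS construction, `G₁` and `G₂`, perturbed by `ε` times the trace, become squared norms
-- `‖Sv‖²` and `‖Rv‖²` with `S`, `R` invertible. Then `T x = (S⋆)⁻¹ [F(E_ij x)] R⁻¹` is completely
-- contractive by the first inequality and almost norms `x₀` by the second.

universe v

/-! ### Norming functionals and positive forms on matrices. -/

section

open scoped Matrix.Norms.L2Operator Matrix ComplexOrder

/-- A complex Hahn–Banach theorem for seminorms: a norming functional with real part dominated by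
the seminorm. -/
theorem Seminorm.exists_re_le_re_eq {V : Type*} [AddCommGroup V] [Module ℂ V] (p : Seminorm ℂ V)
    (v : V) : ∃ F : V →ₗ[ℂ] ℂ, (∀ x, (F x).re ≤ p x) ∧ (F v).re = p v := by
  obtain ⟨g, hg, hgp⟩ : ∃ g : V →ₗ[ℝ] ℝ, g v = p v ∧ ∀ x, g x ≤ p x := by
    by_cases hv : v = 0
    · exact ⟨0, by simp [hv], fun x => apply_nonneg p x⟩
    · obtain ⟨g, h1, h2⟩ := exists_extension_of_le_sublinear
        (LinearPMap.mkSpanSingleton (K := ℝ) v (p v) hv) p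
        (fun c hc x => by
          rw [← Complex.coe_smul, map_smul_eq_mul]
          simp [abs_of_pos hc])
        (map_add_le_add p) (by
          rintro ⟨x, hx⟩
          obtain ⟨c, rfl⟩ := Submodule.mem_span_singleton.1 hx
          rw [LinearPMap.mkSpanSingleton'_apply]
          change c * p v ≤ p (c • v)
          rw [← Complex.coe_smul, map_smul_eq_mul]
          simpa using mul_le_mul_of_nonneg_right (le_abs_self c) (apply_nonneg p v))
      refine ⟨g, ?_, h2⟩
      exact (h1 ⟨v, Submodule.mem_span_singleton_self v⟩).trans
        (LinearPMap.mkSpanSingleton_apply ℝ ℝ hv (p v))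
  refine ⟨Module.Dual.extendRCLike (𝕜 := ℂ) g, fun x => ?_, ?_⟩
  · exact (Module.Dual.re_extendRCLike_apply (𝕜 := ℂ) g x).trans_le (hgp x)
  · exact (Module.Dual.re_extendRCLike_apply (𝕜 := ℂ) g v).trans hg

theorem Matrix.conjTranspose_mul_self_eq_sum_vecMulVec {m n : Type*} [Fintype m]
    (φ : m → n → ℂ) :
    (Matrix.of φ)ᴴ * Matrix.of φ = ∑ k, Matrix.vecMulVec (star (φ k)) (φ k) := by
  ext i j
  simp [Matrix.mul_apply, Matrix.sum_apply, Matrix.vecMulVec_apply]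

/-- A linear functional on matrices with nonnegative real part on `v⋆ v` is, up to a
perturbation by a multiple of the trace, a squared norm. -/
theorem Matrix.exists_isUnit_norm_sq_eq {n : ℕ} (G : Matrix (Fin n) (Fin n) ℂ →ₗ[ℂ] ℂ)
    (hG : ∀ v : Fin n → ℂ, 0 ≤ (G (Matrix.vecMulVec (star v) v)).re) {ε : ℝ} (hε : 0 < ε) :
    ∃ S : Matrix (Fin n) (Fin n) ℂ, IsUnit S ∧ ∀ v : Fin n → ℂ,
      ‖WithLp.toLp 2 (S *ᵥ v)‖ ^ 2 =
        (G (Matrix.vecMulVec (star v) v)).re + ε * ‖WithLp.toLp 2 v‖ ^ 2 := by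
  let P₀ : Matrix (Fin n) (Fin n) ℂ := Matrix.of fun i j => G (Matrix.single i j 1)
  have hP₀ (v : Fin n → ℂ) : star v ⬝ᵥ P₀ *ᵥ v = G (Matrix.vecMulVec (star v) v) := by
    conv_rhs => rw [Matrix.matrix_eq_sum_single (Matrix.vecMulVec (star v) v)]
    simp only [map_sum, dotProduct, Matrix.mulVec, Finset.mul_sum]
    refine Finset.sum_congr rfl fun i _ => Finset.sum_congr rfl fun j _ => ?_
    have : Matrix.single i j (Matrix.vecMulVec (star v) v i j) =
        (star (v i) * v j) • Matrix.single i j (1 : ℂ) := by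
      simp [Matrix.vecMulVec_apply]
    rw [this, map_smul]
    simp [P₀]; ring
  -- Only real parts of `G` are controlled, hence the Hermitian part; the `ε` term makes `P`
  -- definite, so its square root is invertible.
  let P : Matrix (Fin n) (Fin n) ℂ := (1 / 2 : ℂ) • (P₀ + P₀ᴴ) + (ε : ℂ) • 1
  have hnorm (v : Fin n → ℂ) : star v ⬝ᵥ v = ((‖WithLp.toLp 2 v‖ ^ 2 : ℝ) : ℂ) := by
    simp [EuclideanSpace.norm_sq_eq, dotProduct, Complex.conj_mul']
  have hPv (v : Fin n → ℂ) : star v ⬝ᵥ P *ᵥ v =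
      (((G (Matrix.vecMulVec (star v) v)).re + ε * ‖WithLp.toLp 2 v‖ ^ 2 : ℝ) : ℂ) := by
    have h1 : star v ⬝ᵥ P₀ᴴ *ᵥ v = star (G (Matrix.vecMulVec (star v) v)) := by
      rw [← hP₀, Matrix.star_dotProduct, Matrix.star_mulVec, ← Matrix.dotProduct_mulVec,
        Matrix.conjTranspose_conjTranspose]
    simp only [P, Matrix.add_mulVec, Matrix.smul_mulVec, dotProduct_add, dotProduct_smul, h1, hP₀,
      Matrix.one_mulVec, hnorm]
    apply Complex.ext <;> simp
    ring
  have hP : P.PosDef := by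
    refine .of_dotProduct_mulVec_pos ?_ fun v hv => ?_
    · simp [P, Matrix.IsHermitian, add_comm]
    · rw [hPv, Complex.zero_lt_real]
      have : 0 < ‖WithLp.toLp 2 v‖ := by simpa using hv
      have := hG v
      positivity
  obtain ⟨S, hS⟩ : ∃ S : Matrix (Fin n) (Fin n) ℂ, Sᴴ * S = P := by
    open scoped MatrixOrder in
    refine ⟨CFC.sqrt P, ?_⟩
    have h := (CFC.sqrt_nonneg P).isSelfAdjoint
    rw [← Matrix.star_eq_conjTranspose, h.star_eq]
    exact CFC.sqrt_mul_sqrt_self P hP.posSemidef.nonneg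
  refine ⟨S, ?_, fun v => ?_⟩
  · have := hP.isUnit
    rw [← hS, Matrix.isUnit_iff_isUnit_det, Matrix.det_mul] at this
    exact (Matrix.isUnit_iff_isUnit_det _).2 (isUnit_of_mul_isUnit_right this)
  · have h2 := hPv v
    rw [← hS, ← Matrix.mulVec_mulVec, Matrix.dotProduct_mulVec, ← Matrix.star_mulVec, hnorm] at h2
    exact_mod_cast h2

/-! ### Scalar compressions and stacking. -/

section

variable {X : Type*} [AddCommGroup X] [Module ℂ X]

theorem scalarMatrixMul_eq_sum {m n : ℕ} (φ ψ : Matrix (Fin m) (Fin n) ℂ)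
    (x : Matrix (Fin m) (Fin m) X) :
    scalarMatrixMul φᴴ x ψ =
      ∑ k, ∑ l, ∑ i, ∑ j, (star (φ k i) * ψ l j) • Matrix.single i j (x k l) := by
  ext i j
  simp [scalarMatrixMul, Matrix.sum_apply, Matrix.single_apply, ite_and]

theorem scalarMatrixMul_smul_smul {m n : ℕ} (c : ℂ) (α : Matrix (Fin n) (Fin m) ℂ)
    (β : Matrix (Fin m) (Fin n) ℂ) (x : Matrix (Fin m) (Fin m) X) :
    scalarMatrixMul (c • α) x (c • β) = (c * c) • scalarMatrixMul α x β := by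
  ext i j
  simp only [scalarMatrixMul, Matrix.of_apply, Matrix.smul_apply, Finset.smul_sum, smul_smul]
  simp only [smul_eq_mul]
  refine Finset.sum_congr rfl fun k _ => Finset.sum_congr rfl fun l _ => ?_
  congr 1; ring

/-- Stacking two rectangular matrices with the same number of columns. -/
def matrixStack {m r n : ℕ} (φ : Matrix (Fin m) (Fin n) ℂ) (φ' : Matrix (Fin r) (Fin n) ℂ) :
    Matrix (Fin (m + r)) (Fin n) ℂ := Matrix.of (Fin.append φ φ')

@[simp]
theorem matrixStack_castAdd {m r n : ℕ} (φ : Matrix (Fin m) (Fin n) ℂ)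
    (φ' : Matrix (Fin r) (Fin n) ℂ) (k : Fin m) (j : Fin n) :
    matrixStack φ φ' (Fin.castAdd r k) j = φ k j :=
  congrFun (Fin.append_left φ φ' k) j

@[simp]
theorem matrixStack_natAdd {m r n : ℕ} (φ : Matrix (Fin m) (Fin n) ℂ)
    (φ' : Matrix (Fin r) (Fin n) ℂ) (k : Fin r) (j : Fin n) :
    matrixStack φ φ' (Fin.natAdd m k) j = φ' k j :=
  congrFun (Fin.append_right φ φ' k) j

theorem matrixStack_conjTranspose_mul_self {m r n : ℕ} (φ : Matrix (Fin m) (Fin n) ℂ)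
    (φ' : Matrix (Fin r) (Fin n) ℂ) :
    (matrixStack φ φ')ᴴ * matrixStack φ φ' = φᴴ * φ + φ'ᴴ * φ' := by
  ext i j
  simp [Matrix.mul_apply, Fin.sum_univ_add]

/-- The zero off-diagonal blocks remove the cross terms. This closes the cone of triples under
addition. -/
theorem scalarMatrixMul_matrixStack {m r n : ℕ} (φ ψ : Matrix (Fin m) (Fin n) ℂ)
    (φ' ψ' : Matrix (Fin r) (Fin n) ℂ)
    (x : Matrix (Fin m) (Fin m) X) (x' : Matrix (Fin r) (Fin r) X) :
    scalarMatrixMul (matrixStack φ φ')ᴴ (matrixDirectSum x x') (matrixStack ψ ψ') =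
      scalarMatrixMul φᴴ x ψ + scalarMatrixMul φ'ᴴ x' ψ' := by
  ext i j
  simp [scalarMatrixMul, matrixDirectSum, Fin.sum_univ_add]

end

/-! ### The separation argument. -/

section

variable {X : Type*} [AddCommGroup X] [Module ℂ X]

/-- The functionals on matrices obtained by separating the cone of the triples
`(φ⋆ φ, ψ⋆ ψ, 2 F (φ⋆ x ψ))` from the strict epigraph of the norm. -/
theorem IsOperatorSpace.exists_re_le_add {O : MatrixSeminorms X} (hO : IsOperatorSpace O) {n : ℕ}
    (F : Matrix (Fin n) (Fin n) X →ₗ[ℂ] ℂ) (hF : ∀ x, (F x).re ≤ O n x) :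
    ∃ G₁ G₂ : Matrix (Fin n) (Fin n) ℂ →ₗ[ℂ] ℂ, (G₁ 1).re + (G₂ 1).re ≤ 2 ∧
      ∀ (r : ℕ) (φ ψ : Matrix (Fin r) (Fin n) ℂ) (x : Matrix (Fin r) (Fin r) X), O r x ≤ 1 →
        2 * (F (scalarMatrixMul φᴴ x ψ)).re ≤ (G₁ (φᴴ * φ)).re + (G₂ (ψᴴ * ψ)).re := by
  let V := Matrix (Fin n) (Fin n) ℂ
  let D : Set (V × V × ℂ) := {z | ‖z.1‖ + ‖z.2.1‖ < z.2.2.re}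
  let C : Set (V × V × ℂ) := {z | ∃ (r : ℕ) (φ ψ : Matrix (Fin r) (Fin n) ℂ)
    (x : Matrix (Fin r) (Fin r) X), O r x ≤ 1 ∧
      z = (φᴴ * φ, ψᴴ * ψ, 2 * F (scalarMatrixMul φᴴ x ψ))}
  have hD : Convex ℝ D := by
    rintro ⟨a, b, s⟩ h ⟨a', b', s'⟩ h' u v hu hv huv
    simp only [D, Set.mem_ofPred_eq, Prod.smul_mk, Prod.mk_add_mk, Complex.add_re,
      Complex.smul_re, smul_eq_mul] at h h' ⊢
    have h1 := norm_add_le (u • a) (v • a')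
    have h2 := norm_add_le (u • b) (v • b')
    rw [norm_smul_of_nonneg hu, norm_smul_of_nonneg hv] at h1 h2
    rcases hu.eq_or_lt with rfl | hu
    · obtain rfl : v = 1 := by simpa using huv
      linarith
    · have := mul_lt_mul_of_pos_left h hu
      have := mul_le_mul_of_nonneg_left h'.le hv
      linarith
  have hDo : IsOpen D := isOpen_lt (by fun_prop) (by fun_prop)
  -- Scaling `φ` and `ψ` by `√c` leaves `x`, and so the bound on `O r x`, untouched.
  have hsmul : ∀ c : ℝ, 0 ≤ c → ∀ z ∈ C, c • z ∈ C := by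
    rintro c hc _ ⟨r, φ, ψ, x, hx, rfl⟩
    obtain ⟨d, hd, h⟩ : ∃ d : ℂ, star d = d ∧ d * d = c :=
      ⟨(√c : ℝ), by simp, by exact_mod_cast Real.mul_self_sqrt hc⟩
    refine ⟨r, d • φ, d • ψ, x, hx, ?_⟩
    rw [← Complex.coe_smul, Matrix.conjTranspose_smul, Matrix.conjTranspose_smul, hd,
      scalarMatrixMul_smul_smul]
    simp [Matrix.smul_mul, Matrix.mul_smul, smul_smul, h, mul_left_comm]
  have hadd : ∀ z ∈ C, ∀ w ∈ C, z + w ∈ C := by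
    rintro _ ⟨r, φ, ψ, x, hx, rfl⟩ _ ⟨r', φ', ψ', x', hx', rfl⟩
    refine ⟨r + r', matrixStack φ φ', matrixStack ψ ψ', matrixDirectSum x x', ?_, ?_⟩
    · rw [hO.norm_directSum]
      exact max_le hx hx'
    · simp [matrixStack_conjTranspose_mul_self, scalarMatrixMul_matrixStack, mul_add]
  have hC : Convex ℝ C := fun z hz w hw a b ha hb _ =>
    hadd _ (hsmul a ha z hz) _ (hsmul b hb w hw)
  -- The compression axiom gives `2 Re F(φ⋆xψ) ≤ 2‖φ‖‖ψ‖ ≤ ‖φ‖² + ‖ψ‖²`.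
  have hdisj : Disjoint D C := by
    rw [Set.disjoint_left]
    rintro _ h ⟨r, φ, ψ, x, hx, rfl⟩
    replace h : ‖φᴴ * φ‖ + ‖ψᴴ * ψ‖ < (2 * F (scalarMatrixMul φᴴ x ψ)).re := h
    rw [Matrix.l2_opNorm_conjTranspose_mul_self, Matrix.l2_opNorm_conjTranspose_mul_self] at h
    have h1 := (hF (scalarMatrixMul φᴴ x ψ)).trans (hO.norm_scalarMul_le r n φᴴ x ψ)
    rw [Matrix.l2_opNorm_conjTranspose] at h1
    have h2 : ‖φ‖ * O r x * ‖ψ‖ ≤ ‖φ‖ * 1 * ‖ψ‖ := by gcongr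
    have h3 : (2 * F (scalarMatrixMul φᴴ x ψ)).re = 2 * (F (scalarMatrixMul φᴴ x ψ)).re := by
      simp
    nlinarith [sq_nonneg (‖φ‖ - ‖ψ‖)]
  obtain ⟨f, u, hfD, hfC⟩ := RCLike.geometric_hahn_banach_open (𝕜 := ℂ) hD hDo hC hdisj
  have h0C : (0 : V × V × ℂ) ∈ C := ⟨0, 0, 0, 0, by simp, by
    have h : scalarMatrixMul (0 : Matrix (Fin 0) (Fin n) ℂ)ᴴ (0 : Matrix (Fin 0) (Fin 0) X) 0 = 0 := by
      ext; simp [scalarMatrixMul]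
    rw [h]
    simp
    rfl⟩
  have hu : u ≤ 0 := by simpa using hfC 0 h0C
  have hfC' : ∀ z ∈ C, 0 ≤ (f z).re := by
    intro z hz
    by_contra! h
    -- This multiple of `z` would have real value `u - 1`, below the lower bound `u` on the cone.
    have h1 := hfC _ (hsmul ((u - 1) / (f z).re) (div_nonneg_of_nonpos (by linarith) h.le) z hz)
    rw [← Complex.coe_smul, map_smul] at h1
    simp only [RCLike.re_to_complex, smul_eq_mul, Complex.re_ofReal_mul] at h1
    rw [div_mul_cancel₀ _ h.ne] at h1
    linarith
  have hs : (f (0, 0, 1)).re < 0 := (hfD (0, 0, 1) (by simp [D])).trans_le hu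
  have him : (f (0, 0, 1)).im = 0 := by
    by_contra h
    -- `D` ignores the imaginary part of `t`; this `y` would make the real part of `f` vanish at a
    -- point of `D`.
    let y : ℝ := (f (0, 0, 1)).re / (f (0, 0, 1)).im
    have h1 := (hfD (0, 0, 1 + y * Complex.I) (by simp [D])).trans_le hu
    have h2 : ((0, 0, 1 + y * Complex.I) : V × V × ℂ) =
      (1 + y * Complex.I) • ((0, 0, 1) : V × V × ℂ) := by simp
    rw [h2, map_smul] at h1
    simp [y, div_mul_cancel₀ _ h] at h1
  have hdecomp (A B : V) (t : ℂ) : (f (A, B, t)).re =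
      (f (A, 0, 0)).re + (f (0, B, 0)).re + t.re * (f (0, 0, 1)).re := by
    have h2 : ((A, B, t) : V × V × ℂ) = (A, 0, 0) + (0, B, 0) + t • (0, 0, 1) := by simp
    rw [h2, map_add, map_add, map_smul]
    simp [him]
  obtain ⟨s, hs'⟩ : ∃ s, -(f (0, 0, 1)).re = s := ⟨_, rfl⟩
  have hs₀ : 0 < s := by linarith
  rw [show (f (0, 0, 1)).re = -s by linarith] at hdecomp
  -- Dividing by `s` normalises the coefficient of `Re t` to `-1`.
  let G (ι : V →ₗ[ℂ] V × V × ℂ) : V →ₗ[ℂ] ℂ := ((s⁻¹ : ℝ) : ℂ) • (f.toLinearMap ∘ₗ ι)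
  have hG (ι) (A : V) : (f (ι A)).re = s * (G ι A).re := by
    simp only [G, LinearMap.smul_apply, smul_eq_mul, Complex.re_ofReal_mul]
    rw [mul_inv_cancel_left₀ hs₀.ne']
    rfl
  let ι₁ : V →ₗ[ℂ] V × V × ℂ := LinearMap.inl ℂ V (V × ℂ)
  let ι₂ : V →ₗ[ℂ] V × V × ℂ := LinearMap.inr ℂ V (V × ℂ) ∘ₗ LinearMap.inl ℂ V ℂ
  have hdecomp' (A B : V) (t : ℂ) : (f (A, B, t)).re =
      s * ((G ι₁ A).re + (G ι₂ B).re - t.re) := by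
    rw [mul_sub, mul_add, ← hG, ← hG, hdecomp]
    rw [show ι₁ A = (A, 0, 0) from rfl, show ι₂ B = (0, B, 0) from rfl]
    ring
  refine ⟨G ι₁, G ι₂, ?_, fun r φ ψ x hx => ?_⟩
  · refine le_of_forall_pos_lt_add fun δ hδ => ?_
    -- Only an inequality, since the norm is `0` when `n = 0`.
    have h1 : ‖(1 : V)‖ ≤ 1 := by
      have := Matrix.l2_opNorm_conjTranspose_mul_self (1 : V)
      rw [Matrix.conjTranspose_one, one_mul] at this
      nlinarith [norm_nonneg (1 : V)]
    have h2 := (hfD (1, 1, ((2 + δ : ℝ) : ℂ)) (by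
      simp only [D, Set.mem_ofPred_eq, Complex.ofReal_re]; linarith)).trans_le hu
    rw [RCLike.re_to_complex, hdecomp', Complex.ofReal_re] at h2
    have := (pos_iff_neg_of_mul_neg h2).1 hs₀
    linarith
  · have h2 := hfC' _ ⟨r, φ, ψ, x, hx, rfl⟩
    rw [hdecomp'] at h2
    have := nonneg_of_mul_nonneg_right h2 hs₀
    simp only [Complex.mul_re, Complex.re_ofNat, Complex.im_ofNat, zero_mul, sub_zero] at this
    linarith

end

/-! ### Almost norming complete contractions into matrices. -/

section

variable {X : Type*} [AddCommGroup X] [Module ℂ X]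

theorem norm_matrixToOperator_le {H : Type*} [NormedAddCommGroup H] [InnerProductSpace ℂ H]
    {n : ℕ} {a : Matrix (Fin n) (Fin n) (H →L[ℂ] H)} {c : ℝ} (hc : 0 ≤ c)
    (h : ∀ ξ : Fin n → H, ∑ i, ‖∑ j, a i j (ξ j)‖ ^ 2 ≤ c ^ 2 * ∑ j, ‖ξ j‖ ^ 2) :
    ‖matrixToOperator n a‖ ≤ c := by
  refine ContinuousLinearMap.opNorm_le_bound _ hc fun ξ => ?_
  refine (sq_le_sq₀ (norm_nonneg _) (by positivity)).1 ?_
  rw [mul_pow, PiLp.norm_sq_eq_of_L2, PiLp.norm_sq_eq_of_L2]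
  simpa only [matrixToOperator_apply] using h ξ

theorem sum_norm_sq_le_norm_matrixToOperator {H : Type*} [NormedAddCommGroup H]
    [InnerProductSpace ℂ H] {n : ℕ} (a : Matrix (Fin n) (Fin n) (H →L[ℂ] H)) (ξ : Fin n → H) :
    ∑ i, ‖∑ j, a i j (ξ j)‖ ^ 2 ≤ ‖matrixToOperator n a‖ ^ 2 * ∑ j, ‖ξ j‖ ^ 2 := by
  have h := pow_le_pow_left₀ (norm_nonneg _)
    ((matrixToOperator n a).le_opNorm (WithLp.toLp 2 ξ)) 2
  rw [mul_pow, PiLp.norm_sq_eq_of_L2, PiLp.norm_sq_eq_of_L2] at h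
  simpa only [matrixToOperator_apply] using h

theorem re_sum_inner_le_norm_matrixToOperator {H : Type*} [NormedAddCommGroup H]
    [InnerProductSpace ℂ H] {n : ℕ} (a : Matrix (Fin n) (Fin n) (H →L[ℂ] H)) (ξ η : Fin n → H) :
    2 * (∑ i, ∑ j, inner ℂ (η i) (a i j (ξ j))).re ≤
      ‖matrixToOperator n a‖ * (∑ i, ‖η i‖ ^ 2 + ∑ j, ‖ξ j‖ ^ 2) := by
  have h1 : ∑ i, ∑ j, inner ℂ (η i) (a i j (ξ j)) =
      inner ℂ (WithLp.toLp 2 η) (matrixToOperator n a (WithLp.toLp 2 ξ)) := by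
    simp [PiLp.inner_apply, matrixToOperator_apply, inner_sum]
  have h2 := (Complex.re_le_norm _).trans
    (norm_inner_le_norm (𝕜 := ℂ) (WithLp.toLp 2 η) (matrixToOperator n a (WithLp.toLp 2 ξ)))
  have h3 := (matrixToOperator n a).le_opNorm (WithLp.toLp 2 ξ)
  have h4 := PiLp.norm_sq_eq_of_L2 (fun _ : Fin n => H) (WithLp.toLp 2 η)
  have h5 := PiLp.norm_sq_eq_of_L2 (fun _ : Fin n => H) (WithLp.toLp 2 ξ)
  simp only at h4 h5
  rw [h1, ← h4, ← h5]
  have h6 := mul_le_mul_of_nonneg_left h3 (norm_nonneg (WithLp.toLp 2 η))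
  have h7 := mul_nonneg (norm_nonneg (matrixToOperator n a))
    (sq_nonneg (‖WithLp.toLp 2 η‖ - ‖WithLp.toLp 2 ξ‖))
  linarith

/-- The map `x ↦ (S⋆)⁻¹ [F (E_ij x)] R⁻¹` into operators on Euclidean space. -/
noncomputable def compressedFunctional {n : ℕ} (F : Matrix (Fin n) (Fin n) X →ₗ[ℂ] ℂ)
    (S R : Matrix (Fin n) (Fin n) ℂ) :
    X →ₗ[ℂ] (EuclideanSpace ℂ (Fin n) →L[ℂ] EuclideanSpace ℂ (Fin n)) where
  toFun x := Matrix.toEuclideanCLM (n := Fin n) (𝕜 := ℂ)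
    ((S⁻¹)ᴴ * Matrix.of (fun i j => F (Matrix.single i j x)) * R⁻¹)
  map_add' x y := by
    rw [← map_add, ← add_mul, ← mul_add]
    congr
    ext i j
    simp [Matrix.single_add]
  map_smul' c x := by
    rw [RingHom.id_apply, ← map_smul, ← Matrix.smul_mul, ← Matrix.mul_smul]
    congr
    ext i j
    rw [Matrix.smul_apply, Matrix.of_apply, Matrix.of_apply, ← map_smul, Matrix.smul_single]

/-- The inverses in the compressed functional cancel against `S` and `R`. -/
theorem sum_inner_compressedFunctional {n r : ℕ} (F : Matrix (Fin n) (Fin n) X →ₗ[ℂ] ℂ)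
    {S R : Matrix (Fin n) (Fin n) ℂ} (hS : IsUnit S) (hR : IsUnit R)
    (φ ψ : Fin r → Fin n → ℂ) (x : Matrix (Fin r) (Fin r) X) :
    ∑ k, ∑ l, inner ℂ (WithLp.toLp 2 (S *ᵥ φ k))
      (compressedFunctional F S R (x k l) (WithLp.toLp 2 (R *ᵥ ψ l))) =
        F (scalarMatrixMul (Matrix.of φ)ᴴ x (Matrix.of ψ)) := by
  rw [scalarMatrixMul_eq_sum]
  simp only [map_sum]
  refine Finset.sum_congr rfl fun k _ => Finset.sum_congr rfl fun l _ => ?_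
  have hS' := (Matrix.isUnit_iff_isUnit_det _).1 hS
  have hR' := (Matrix.isUnit_iff_isUnit_det _).1 hR
  have h : ∀ M : Matrix (Fin n) (Fin n) ℂ,
      inner ℂ (WithLp.toLp 2 (S *ᵥ φ k)) (Matrix.toEuclideanCLM (n := Fin n) (𝕜 := ℂ)
        ((S⁻¹)ᴴ * M * R⁻¹) (WithLp.toLp 2 (R *ᵥ ψ l))) = star (φ k) ⬝ᵥ M *ᵥ ψ l := by
    intro M
    rw [Matrix.toEuclideanCLM_toLp, EuclideanSpace.inner_toLp_toLp, dotProduct_comm,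
      Matrix.star_mulVec, ← Matrix.dotProduct_mulVec, Matrix.mulVec_mulVec, Matrix.mulVec_mulVec,
      ← mul_assoc, ← mul_assoc, mul_assoc (_ * M), Matrix.nonsing_inv_mul _ hR', mul_one,
      ← Matrix.conjTranspose_mul, Matrix.nonsing_inv_mul _ hS', Matrix.conjTranspose_one, one_mul]
  refine (h _).trans ?_
  simp only [dotProduct, Matrix.mulVec, Finset.mul_sum, map_smul, Matrix.of_apply, smul_eq_mul,
    Pi.star_apply]
  refine Finset.sum_congr rfl fun i _ => Finset.sum_congr rfl fun j _ => ?_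
  ring

theorem re_map_conjTranspose_mul_self {n r : ℕ} (G : Matrix (Fin n) (Fin n) ℂ →ₗ[ℂ] ℂ) {ε : ℝ}
    {S : Matrix (Fin n) (Fin n) ℂ} (hS : ∀ v : Fin n → ℂ, ‖WithLp.toLp 2 (S *ᵥ v)‖ ^ 2 =
        (G (Matrix.vecMulVec (star v) v)).re + ε * ‖WithLp.toLp 2 v‖ ^ 2)
    (φ : Fin r → Fin n → ℂ) :
    ∑ k, ‖WithLp.toLp 2 (S *ᵥ φ k)‖ ^ 2 =
      (G ((Matrix.of φ)ᴴ * Matrix.of φ)).re + ε * ∑ k, ‖WithLp.toLp 2 (φ k)‖ ^ 2 := by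
  simp [Matrix.conjTranspose_mul_self_eq_sum_vecMulVec, hS, Finset.sum_add_distrib,
    Finset.mul_sum]

theorem Matrix.exists_toLp_mulVec_eq {n : ℕ} {S : Matrix (Fin n) (Fin n) ℂ} (hS : IsUnit S)
    (η : EuclideanSpace ℂ (Fin n)) : ∃ v : Fin n → ℂ, WithLp.toLp 2 (S *ᵥ v) = η :=
  ⟨S⁻¹ *ᵥ η.ofLp, by
    rw [Matrix.mulVec_mulVec, Matrix.mul_nonsing_inv _ ((Matrix.isUnit_iff_isUnit_det _).1 hS),
      Matrix.one_mulVec]⟩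

theorem norm_matrixToOperator_le_one_of_re_sum_inner_le {H : Type*} [NormedAddCommGroup H]
    [InnerProductSpace ℂ H] {n : ℕ} {a : Matrix (Fin n) (Fin n) (H →L[ℂ] H)}
    (h : ∀ ξ η : Fin n → H, 2 * (∑ i, ∑ j, inner ℂ (η i) (a i j (ξ j))).re ≤
      ∑ i, ‖η i‖ ^ 2 + ∑ j, ‖ξ j‖ ^ 2) :
    ‖matrixToOperator n a‖ ≤ 1 := by
  refine norm_matrixToOperator_le zero_le_one fun ξ => ?_
  -- Testing with `η = aξ` gives `2‖aξ‖² ≤ ‖aξ‖² + ‖ξ‖²`.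
  have h1 := h ξ fun i => ∑ j, a i j (ξ j)
  have h2 : (∑ i, ∑ j, inner ℂ (∑ j, a i j (ξ j)) (a i j (ξ j))).re =
      ∑ i, ‖∑ j, a i j (ξ j)‖ ^ 2 := by
    simp only [← inner_sum, Complex.re_sum]
    exact Finset.sum_congr rfl fun k _ => inner_self_eq_norm_sq (𝕜 := ℂ) _
  rw [h2] at h1
  linarith

theorem norm_smul_continuousLinearMap_piLp {H : Type*} [NormedAddCommGroup H]
    [InnerProductSpace ℂ H] {n : ℕ} (c : ℂ)
    (A : PiLp 2 (fun _ : Fin n => H) →L[ℂ] PiLp 2 (fun _ : Fin n => H)) :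
    ‖c • A‖ = ‖c‖ * ‖A‖ :=
  map_smul_eq_mul
    (normSeminorm ℂ (PiLp 2 (fun _ : Fin n => H) →L[ℂ] PiLp 2 (fun _ : Fin n => H))) c A

theorem norm_matrixToOperator_map_le {H : Type*} [NormedAddCommGroup H]
    [InnerProductSpace ℂ H] {O : MatrixSeminorms X} {T : X →ₗ[ℂ] (H →L[ℂ] H)} {r : ℕ}
    (h : ∀ y : Matrix (Fin r) (Fin r) X, O r y ≤ 1 → ‖matrixToOperator r (y.map T)‖ ≤ 1)
    (x : Matrix (Fin r) (Fin r) X) : ‖matrixToOperator r (x.map T)‖ ≤ O r x := by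
  refine le_of_forall_pos_le_add fun δ hδ => ?_
  have hc : 0 < O r x + δ := by have := apply_nonneg (O r) x; linarith
  set c := O r x + δ
  have h := h (((c⁻¹ : ℝ) : ℂ) • x) (by
    rw [map_smul_eq_mul, Complex.norm_real, Real.norm_of_nonneg (by positivity),
      inv_mul_le_iff₀ hc]
    linarith)
  rw [Matrix.map_smul _ _ (fun y => map_smul _ _ y), map_smul,
    norm_smul_continuousLinearMap_piLp, Complex.norm_real,
    Real.norm_of_nonneg (by positivity), inv_mul_le_iff₀ hc] at h
  linarith

/-- Every matrix over an abstract operator space is almost normed by a completely contractive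
map into the operators on a Euclidean space. -/
theorem IsOperatorSpace.exists_completeContraction {O : MatrixSeminorms X}
    (hO : IsOperatorSpace O) {n : ℕ} (x₀ : Matrix (Fin n) (Fin n) X) {ε : ℝ} (hε : 0 < ε) :
    ∃ T : X →ₗ[ℂ] (EuclideanSpace ℂ (Fin n) →L[ℂ] EuclideanSpace ℂ (Fin n)),
      (∀ (r : ℕ) (x : Matrix (Fin r) (Fin r) X), ‖matrixToOperator r (x.map T)‖ ≤ O r x) ∧
      O n x₀ ≤ ‖matrixToOperator n (x₀.map T)‖ * (1 + ε * n) := by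
  obtain ⟨F, hF, hF₀⟩ := (O n).exists_re_le_re_eq x₀
  obtain ⟨G₁, G₂, hG, hFG⟩ := hO.exists_re_le_add F hF
  have hz : (Matrix.of fun _ _ => 0 : Matrix (Fin n) (Fin n) X) = 0 := rfl
  have hG₁ (v : Fin n → ℂ) : 0 ≤ (G₁ (Matrix.vecMulVec (star v) v)).re := by
    -- A single row `v`, with `ψ = 0` and `x = 0`, isolates `G₁`.
    have h := hFG 1 (Matrix.of fun _ => v) 0 0 (by simp)
    simpa [scalarMatrixMul, Matrix.conjTranspose_mul_self_eq_sum_vecMulVec, hz] using h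
  have hG₂ (v : Fin n → ℂ) : 0 ≤ (G₂ (Matrix.vecMulVec (star v) v)).re := by
    have h := hFG 1 0 (Matrix.of fun _ => v) 0 (by simp)
    simpa [scalarMatrixMul, Matrix.conjTranspose_mul_self_eq_sum_vecMulVec, hz] using h
  obtain ⟨S, hSu, hS⟩ := Matrix.exists_isUnit_norm_sq_eq G₁ hG₁ hε
  obtain ⟨R, hRu, hR⟩ := Matrix.exists_isUnit_norm_sq_eq G₂ hG₂ hε
  refine ⟨compressedFunctional F S R, fun r x => ?_, ?_⟩
  · refine norm_matrixToOperator_map_le (fun y hy => ?_) x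
    refine norm_matrixToOperator_le_one_of_re_sum_inner_le fun ξ η => ?_
    choose φ hφ using fun k => Matrix.exists_toLp_mulVec_eq hSu (η k)
    choose ψ hψ using fun k => Matrix.exists_toLp_mulVec_eq hRu (ξ k)
    have h1 := hFG r (Matrix.of φ) (Matrix.of ψ) y hy
    rw [← sum_inner_compressedFunctional F hSu hRu] at h1
    have h2 := re_map_conjTranspose_mul_self G₁ hS φ
    have h3 := re_map_conjTranspose_mul_self G₂ hR ψ
    simp only [hφ, hψ] at h1 h2 h3
    have h5 : 0 ≤ ε * ∑ k, ‖WithLp.toLp 2 (φ k)‖ ^ 2 := by positivity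
    have h6 : 0 ≤ ε * ∑ k, ‖WithLp.toLp 2 (ψ k)‖ ^ 2 := by positivity
    simp only [Matrix.map_apply]
    linarith
  -- With `φ = ψ = 1` the pairing returns `F(x₀)`, while the squared norms total at most `2 + 2εn`.
  · let e : Fin n → Fin n → ℂ := fun k => Pi.single k 1
    have he : Matrix.of e = 1 := by
      ext i j
      simp [e, Matrix.one_apply, Pi.single_apply, eq_comm]
    have h1 := sum_inner_compressedFunctional F hSu hRu e e x₀
    have h2 : scalarMatrixMul (1 : Matrix (Fin n) (Fin n) ℂ)ᴴ x₀ 1 = x₀ := by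
      ext i j
      simp [scalarMatrixMul, Matrix.one_apply]
    rw [he, h2] at h1
    have h3 := re_sum_inner_le_norm_matrixToOperator (x₀.map (compressedFunctional F S R))
      (fun l => WithLp.toLp 2 (R *ᵥ e l)) (fun k => WithLp.toLp 2 (S *ᵥ e k))
    simp only [Matrix.map_apply] at h3
    have h4 : ∑ k, ‖WithLp.toLp 2 (e k)‖ ^ 2 = n := by simp [e]
    rw [h1, hF₀, re_map_conjTranspose_mul_self G₁ hS, re_map_conjTranspose_mul_self G₂ hR, h4,
      he, Matrix.conjTranspose_one, one_mul] at h3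
    have h5 := mul_le_mul_of_nonneg_left hG
      (norm_nonneg (matrixToOperator n (x₀.map (compressedFunctional F S R))))
    linarith

end

end

/-! ### Hilbert sums of complete contractions. -/

section

variable {ι : Type*} {K : ι → Type*} [∀ i, NormedAddCommGroup (K i)]

theorem lp.sum_norm_sq_le_norm_sq (f : lp K 2) (s : Finset ι) : ∑ i ∈ s, ‖f i‖ ^ 2 ≤ ‖f‖ ^ 2 := by
  simpa using lp.sum_rpow_le_norm_rpow (p := 2) (by norm_num) f s

theorem lp.norm_sq_eq_tsum (f : lp K 2) : ‖f‖ ^ 2 = ∑' i, ‖f i‖ ^ 2 := by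
  simpa using lp.norm_rpow_eq_tsum (p := 2) (by norm_num) f

theorem lp.summable_norm_sq (f : lp K 2) : Summable fun i => ‖f i‖ ^ 2 := by
  simpa using (lp.memℓp f).summable (by norm_num)

theorem lp.sum_apply {J : Type*} (s : Finset J) (f : J → lp K 2) (i : ι) :
    (∑ j ∈ s, f j : lp K 2) i = ∑ j ∈ s, f j i := by
  rw [lp.coeFn_sum]
  exact Finset.sum_apply i s fun j => (f j : ∀ i, K i)

variable [∀ i, InnerProductSpace ℂ (K i)]

/-- The diagonal operator on the Hilbert sum with uniformly bounded diagonal entries. -/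
noncomputable def lp.diagonalCLM (A : ∀ i, K i →L[ℂ] K i) {C : ℝ} (hA : ∀ i, ‖A i‖ ≤ C) :
    lp K 2 →L[ℂ] lp K 2 :=
  have hle (f : lp K 2) (s : Finset ι) : ∑ i ∈ s, ‖A i (f i)‖ ^ 2 ≤ (|C| * ‖f‖) ^ 2 := by
    calc ∑ i ∈ s, ‖A i (f i)‖ ^ 2 ≤ ∑ i ∈ s, C ^ 2 * ‖f i‖ ^ 2 := by
          gcongr with i
          rw [← mul_pow]
          gcongr
          exact (A i).le_of_opNorm_le (hA i) _
      _ ≤ (|C| * ‖f‖) ^ 2 := by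
          rw [← Finset.mul_sum, mul_pow, sq_abs]
          gcongr
          exact lp.sum_norm_sq_le_norm_sq f s
  LinearMap.mkContinuous
    { toFun := fun f => ⟨fun i => A i (f i),
        memℓp_gen' (C := (|C| * ‖f‖) ^ 2) fun s => by simpa using hle f s⟩
      map_add' := fun f g => by
        ext i
        exact map_add (A i) (f i) (g i)
      map_smul' := fun c f => by
        ext i
        exact map_smul (A i) c (f i) }
    |C| fun f => lp.norm_le_of_forall_sum_le (p := 2) (by norm_num) (by positivity)
      fun s => by simpa using hle f s

theorem lp.diagonalCLM_apply (A : ∀ i, K i →L[ℂ] K i) {C : ℝ} (hA : ∀ i, ‖A i‖ ≤ C)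
    (f : lp K 2) (i : ι) : lp.diagonalCLM A hA f i = A i (f i) := rfl

end

section

variable {X : Type*} [AddCommGroup X] [Module ℂ X]

/-- The case `r = 1` gives a bound independent of `T`, so that the diagonal operator on the Hilbert
sum is bounded. -/
theorem norm_le_of_completeContraction {H : Type*} [NormedAddCommGroup H]
    [InnerProductSpace ℂ H] {O : MatrixSeminorms X} {T : X →ₗ[ℂ] (H →L[ℂ] H)}
    (hT : ∀ (r : ℕ) (x : Matrix (Fin r) (Fin r) X), ‖matrixToOperator r (x.map T)‖ ≤ O r x)
    (x : X) : ‖T x‖ ≤ O 1 (Matrix.of fun _ _ => x) := by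
  refine ContinuousLinearMap.opNorm_le_bound _ (apply_nonneg _ _) fun ξ => ?_
  have h := sum_norm_sq_le_norm_matrixToOperator
    ((Matrix.of fun _ _ : Fin 1 => x).map T) (fun _ => ξ)
  simp only [Finset.univ_unique, Finset.sum_singleton, Matrix.map_apply, Matrix.of_apply] at h
  rw [← mul_pow, sq_le_sq₀ (norm_nonneg _) (by positivity)] at h
  exact h.trans (by gcongr; exact hT _ _)

variable {ι : Type*} {K : ι → Type*} [∀ i, NormedAddCommGroup (K i)]
  [∀ i, InnerProductSpace ℂ (K i)]

/-- The Hilbert sum of a family of completely contractive maps. -/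
noncomputable def directSumCompleteContraction {O : MatrixSeminorms X}
    (T : ∀ i, X →ₗ[ℂ] (K i →L[ℂ] K i))
    (hT : ∀ (i : ι) (r : ℕ) (x : Matrix (Fin r) (Fin r) X),
      ‖matrixToOperator r (x.map (T i))‖ ≤ O r x) :
    X →ₗ[ℂ] (lp K 2 →L[ℂ] lp K 2) where
  toFun x := lp.diagonalCLM (fun i => T i x) fun i => norm_le_of_completeContraction (hT i) x
  map_add' x y := by
    ext f i
    simp [lp.diagonalCLM_apply]
  map_smul' c x := by
    ext f i
    simp [lp.diagonalCLM_apply]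

theorem directSumCompleteContraction_apply {O : MatrixSeminorms X}
    (T : ∀ i, X →ₗ[ℂ] (K i →L[ℂ] K i))
    (hT : ∀ (i : ι) (r : ℕ) (x : Matrix (Fin r) (Fin r) X),
      ‖matrixToOperator r (x.map (T i))‖ ≤ O r x) (x : X) (f : lp K 2) (i : ι) :
    directSumCompleteContraction T hT x f i = T i x (f i) := rfl

theorem norm_directSumCompleteContraction_le {O : MatrixSeminorms X}
    (T : ∀ i, X →ₗ[ℂ] (K i →L[ℂ] K i))
    (hT : ∀ (i : ι) (r : ℕ) (x : Matrix (Fin r) (Fin r) X),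
      ‖matrixToOperator r (x.map (T i))‖ ≤ O r x) {r : ℕ} (x : Matrix (Fin r) (Fin r) X) :
    ‖matrixToOperator r (x.map (directSumCompleteContraction T hT))‖ ≤ O r x := by
  refine norm_matrixToOperator_le (apply_nonneg _ _) fun ξ => ?_
  simp only [lp.norm_sq_eq_tsum]
  rw [← Summable.tsum_finsetSum fun i _ => lp.summable_norm_sq _,
    ← Summable.tsum_finsetSum fun i _ => lp.summable_norm_sq _, ← tsum_mul_left]
  refine Summable.tsum_le_tsum (fun i => ?_) (summable_sum fun i _ => lp.summable_norm_sq _)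
    ((summable_sum fun i _ => lp.summable_norm_sq _).mul_left _)
  have h := sum_norm_sq_le_norm_matrixToOperator (x.map (T i)) (fun j => ξ j i)
  have h2 : ‖matrixToOperator r (x.map (T i))‖ ^ 2 * ∑ j, ‖ξ j i‖ ^ 2 ≤
      O r x ^ 2 * ∑ j, ‖ξ j i‖ ^ 2 := by
    gcongr
    exact hT i r x
  simp only [lp.sum_apply]
  exact h.trans h2

theorem norm_le_norm_directSumCompleteContraction {O : MatrixSeminorms X}
    (T : ∀ i, X →ₗ[ℂ] (K i →L[ℂ] K i))
    (hT : ∀ (i : ι) (r : ℕ) (x : Matrix (Fin r) (Fin r) X),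
      ‖matrixToOperator r (x.map (T i))‖ ≤ O r x) (i : ι) {r : ℕ}
    (x : Matrix (Fin r) (Fin r) X) :
    ‖matrixToOperator r (x.map (T i))‖ ≤
      ‖matrixToOperator r (x.map (directSumCompleteContraction T hT))‖ := by
  classical
  refine norm_matrixToOperator_le (ContinuousLinearMap.opNorm_nonneg _) fun ξ => ?_
  have h := sum_norm_sq_le_norm_matrixToOperator (x.map (directSumCompleteContraction T hT))
    -- Vectors supported in the `i`-th summand only see `T i`.
    (fun j => lp.single 2 i (ξ j))
  simp only [lp.norm_single (p := 2) (by norm_num)] at h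
  refine le_trans (Finset.sum_le_sum fun k _ => pow_le_pow_left₀ (norm_nonneg _) ?_ 2) h
  refine le_trans (le_of_eq ?_) (lp.norm_apply_le_norm (p := 2) (by norm_num) _ i)
  rw [lp.sum_apply]
  simp only [Matrix.map_apply, directSumCompleteContraction_apply, lp.single_apply_self]

theorem norm_directSumCompleteContraction {O : MatrixSeminorms X}
    (T : ∀ i, X →ₗ[ℂ] (K i →L[ℂ] K i))
    (hT : ∀ (i : ι) (r : ℕ) (x : Matrix (Fin r) (Fin r) X),
      ‖matrixToOperator r (x.map (T i))‖ ≤ O r x) {n : ℕ} (x : Matrix (Fin n) (Fin n) X)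
    (h : ∀ ε : ℝ, 0 < ε → ∃ i, O n x ≤ ‖matrixToOperator n (x.map (T i))‖ * (1 + ε * n)) :
    ‖matrixToOperator n (x.map (directSumCompleteContraction T hT))‖ = O n x := by
  refine le_antisymm (norm_directSumCompleteContraction_le T hT x) ?_
  have hle (i : ι) := norm_le_norm_directSumCompleteContraction T hT i x
  have hN₀ : 0 ≤ ‖matrixToOperator n (x.map (directSumCompleteContraction T hT))‖ :=
    ContinuousLinearMap.opNorm_nonneg _
  generalize ‖matrixToOperator n (x.map (directSumCompleteContraction T hT))‖ = N at hle hN₀ ⊢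
  refine le_of_forall_pos_le_add fun δ hδ => ?_
  have hpos : 0 < N * n + 1 := by positivity
  -- This `ε` keeps the error `N * ε * n` below `δ`; the `+ 1` covers `N * n = 0`.
  obtain ⟨i, hi⟩ := h _ (div_pos hδ hpos)
  refine hi.trans ((mul_le_mul_of_nonneg_right (hle i) (by positivity)).trans ?_)
  have h2 : N * (1 + δ / (N * n + 1) * n) = N + δ * ((N * n) / (N * n + 1)) := by ring
  have h3 : N * n / (N * n + 1) ≤ 1 := (div_le_one hpos).2 (by linarith)
  rw [h2]
  linarith [mul_le_mul_of_nonneg_left h3 hδ.le]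

end

/-! ### The concrete realisation. -/

theorem exists_concreteOperatorSpace {X : Type u} {H : Type v} [AddCommGroup X] [Module ℂ X]
    [NormedAddCommGroup H] [InnerProductSpace ℂ H] [CompleteSpace H] {O : MatrixSeminorms X}
    (Φ : X →ₗ[ℂ] (H →L[ℂ] H))
    (hΦ : ∀ (n : ℕ) (x : Matrix (Fin n) (Fin n) X), ‖matrixToOperator n (x.map Φ)‖ = O n x) :
    ∃ (H : Type v) (_ : NormedAddCommGroup H) (_ : InnerProductSpace ℂ H) (_ : CompleteSpace H)
      (Y : Submodule ℂ (H →L[ℂ] H)) (Ψ : X →ₗ[ℂ] Y),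
      Function.Surjective Ψ ∧ IsCompleteIsometry O (concreteMatrixNorms Y) Ψ :=
  ⟨H, inferInstance, inferInstance, inferInstance, LinearMap.range Φ, Φ.rangeRestrict,
    Φ.surjective_rangeRestrict, hΦ⟩

/-- A completely contractive linear map into the operators on some finite-dimensional Euclidean
space. -/
structure EuclideanCompleteContraction {X : Type u} [AddCommGroup X] [Module ℂ X]
    (O : MatrixSeminorms X) : Type u where
  dim : ℕ
  toLinearMap : X →ₗ[ℂ] (EuclideanSpace ℂ (Fin dim) →L[ℂ] EuclideanSpace ℂ (Fin dim))
  norm_map_le : ∀ (r : ℕ) (x : Matrix (Fin r) (Fin r) X),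
    ‖matrixToOperator r (x.map toLinearMap)‖ ≤ O r x

theorem corollary2p5 {X : Type u} [AddCommGroup X] [Module ℂ X] (O : MatrixSeminorms X)
    (hO : IsOperatorSpace O) :
    ∃ (H : Type u) (_ : NormedAddCommGroup H) (_ : InnerProductSpace ℂ H) (_ : CompleteSpace H)
      (Y : Submodule ℂ (H →L[ℂ] H)) (Ψ : X →ₗ[ℂ] Y),
      Function.Surjective Ψ ∧ IsCompleteIsometry O (concreteMatrixNorms Y) Ψ := by
  -- Summing over all contractions into Euclidean spaces keeps the Hilbert space in the universe of
  -- `X`.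
  refine exists_concreteOperatorSpace (directSumCompleteContraction
    (fun T : EuclideanCompleteContraction O => T.toLinearMap) fun T => T.norm_map_le) fun n x => ?_
  refine norm_directSumCompleteContraction _ _ x fun ε hε => ?_
  obtain ⟨S, hS, hle⟩ := hO.exists_completeContraction x hε
  exact ⟨⟨n, S, hS⟩, hle⟩
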